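/- Let $x_1,x_2,\dots$ be independent, identically distributed random vectors in $\mathbb{R}^p$ whose common law is elliptical, i.e. has characteristic function $t\mapsto e^{i t^\top m}\,\psi(t^\top S t)$ for some $m\in\mathbb{R}^p$, some positive semidefinite matrix $S$ and some function $\psi$. Assume that the law has finite fourth moments. Let $\mu$ and $\Sigma$ be its mean and covariance matrix, assume $\Sigma_{ii}>0$ for all $i$, and put $\sigma_i=\sqrt{\Sigma_{ii}}$, $R=\operatorname{diag}(\sigma^{-1})\,\Sigma\,\operatorname{diag}(\sigma^{-1})$. For a fixed (risk-free rate) $r\in\mathbb{R}$ let $\zeta_i=(\mu_i-r)/\sigma_i$ be the signal-noise ratios, and let $$\hat\zeta_i=\frac{\hat\mu_i-r}{\sqrt{\hat\alpha_i-\hat\mu_i^2}},\qquad \hat\mu_i=\frac1n\sum_{k=1}^n x_{k,i},\quad \hat\alpha_i=\frac1n\sum_{k=1}^n x_{k,i}^2,$$ be the sample Sharpe ratios computed from $n$ observations. Then all the marginals have the same kurtosis $E(x_{1,i}-\mu_i)^4/\sigma_i^4$; let $\kappa$ (the kurtosis factor) be one third of it. With $\circ$ the entrywise product, the matrix $$V=R+\frac{\kappa-1}{4}\,\zeta\zeta^\top+\frac{\kappa}{2}\operatorname{diag}(\zeta)\,(R\circ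 R)\operatorname{diag}(\zeta)$$ is positive semidefinite and, as $n\to\infty$, $$\sqrt n\,(\hat\zeta-\zeta)\ \rightsquigarrow\ N(0,V),$$ i.e. $\hat\zeta$ is approximately $N(\zeta,\frac1n V)$. Moreover $V_{ii}=1-\gamma_{3,i}\,\zeta_i+\frac{\gamma_{4,i}-1}{4}\zeta_i^2$ for every $i$, where $\gamma_{3,i}$ and $\gamma_{4,i}$ are the skewness and the kurtosis of the $i$-th marginal; in particular, for $p=1$, the standard error $\sqrt{V/n}$ is the one of Mertens. -/

import Mathlib

open MeasureTheory ProbabilityTheory Filter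
open scoped Matrix Topology

namespace Sharpe

noncomputable section

/-- A law `ν` on `ℝᵖ` is *elliptical*: for some location `m`, some positive semidefinite scatter
matrix `S` and some function `ψ` (the characteristic generator), its characteristic function is
`t ↦ exp (i tᵀm) ψ(tᵀ S t)`. -/
def IsElliptical {p : ℕ} (ν : Measure (EuclideanSpace ℝ (Fin p))) : Prop :=
  ∃ (m : EuclideanSpace ℝ (Fin p)) (S : Matrix (Fin p) (Fin p) ℝ) (ψ : ℝ → ℂ),
    S.PosSemidef ∧
    ∀ t : EuclideanSpace ℝ (Fin p),
      charFun ν t = Complex.exp ((inner ℝ t m : ℝ) * Complex.I) * ψ (t ⬝ᵥ S *ᵥ t)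

/-! ### Population quantities of a law on `ℝᵖ` -/

section Population

variable {p : ℕ} (ν : Measure (EuclideanSpace ℝ (Fin p)))

/-- Vector of means. -/
def popMean (i : Fin p) : ℝ := ∫ x, x i ∂ν

/-- Vector of uncentred second moments. -/
def popMom2 (i : Fin p) : ℝ := ∫ x, x i ^ 2 ∂ν

/-- Covariance matrix. -/
def popCov : Matrix (Fin p) (Fin p) ℝ :=
  Matrix.of fun i j => ∫ x, (x i - popMean ν i) * (x j - popMean ν j) ∂ν

/-- Vector of standard deviations: the square root of the diagonal of the covariance matrix. -/
def popSigma (i : Fin p) : ℝ := √(popCov ν i i)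

/-- Correlation matrix `diag(σ⁻¹) Σ diag(σ⁻¹)`. -/
def popCorr : Matrix (Fin p) (Fin p) ℝ :=
  Matrix.diagonal (fun i => (popSigma ν i)⁻¹) * popCov ν *
    Matrix.diagonal (fun i => (popSigma ν i)⁻¹)

/-- Skewness of the `i`-th marginal. -/
def popSkew (i : Fin p) : ℝ := (∫ x, (x i - popMean ν i) ^ 3 ∂ν) / popSigma ν i ^ 3

/-- Kurtosis (not excess kurtosis) of the `i`-th marginal. -/
def popKurt (i : Fin p) : ℝ := (∫ x, (x i - popMean ν i) ^ 4 ∂ν) / popSigma ν i ^ 4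

/-- Vector of signal-noise ratios with respect to the risk-free rate `r`. -/
def popSNR (r : ℝ) : EuclideanSpace ℝ (Fin p) :=
  WithLp.toLp 2 fun i => (popMean ν i - r) / √(popMom2 ν i - popMean ν i ^ 2)

end Population

/-! ### Sample quantities, from the first `n` observations `x 0, …, x (n - 1)` -/

section Sample

variable {p : ℕ} (x : ℕ → EuclideanSpace ℝ (Fin p)) (n : ℕ)

/-- Sample mean. -/
def sampleMean (i : Fin p) : ℝ := (1 / (n : ℝ)) * ∑ k ∈ Finset.range n, x k i

/-- Sample uncentred second moment. -/
def sampleMom2 (i : Fin p) : ℝ := (1 / (n : ℝ)) * ∑ k ∈ Finset.range n, x k i ^ 2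

/-- Vector of sample Sharpe ratios with respect to the risk-free rate `r`. -/
def sampleSharpe (r : ℝ) : EuclideanSpace ℝ (Fin p) :=
  WithLp.toLp 2 fun i => (sampleMean x n i - r) / √(sampleMom2 x n i - sampleMean x n i ^ 2)

end Sample

/-- The matrix `R + ((κ - 1) / 4) ζ ζᵀ + (κ / 2) diag(ζ) (R ⊙ R) diag(ζ)`. -/
def asympCov {p : ℕ} (κ : ℝ) (R : Matrix (Fin p) (Fin p) ℝ) (ζ : Fin p → ℝ) :
    Matrix (Fin p) (Fin p) ℝ :=
  R + ((κ - 1) / 4) • Matrix.vecMulVec ζ ζ +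
    (κ / 2) • (Matrix.diagonal ζ * (R ⊙ R) * Matrix.diagonal ζ)

/-- Mertens' asymptotic variance of the Sharpe ratio of one asset with skewness `γ₃`, kurtosis
`γ₄` and signal-noise ratio `ζ`; Mertens' standard error from `n` observations is the square
root of this over `n`. -/
def mertensVariance (γ₃ γ₄ ζ : ℝ) : ℝ := 1 - γ₃ * ζ + (γ₄ - 1) / 4 * ζ ^ 2

end

end Sharpe

/-!
The proof is the delta method around the multivariate central limit theorem, with the limit
covariance computed from the symmetry of elliptical laws.

*Moments.* The centred projection of an elliptical vector `x` on a direction `a` has the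
characteristic function `s ↦ ψ (s² aᵀSa)`, so its law depends on `a` only through `aᵀSa`, up to
scaling (`Sharpe.map_inner_sub_eq`). Hence odd central moments of projections vanish, and every
projection has the same kurtosis `K` as the marginals: `E⟪x - m, a⟫⁴ = K (E⟪x - m, a⟫²)²`
(`Sharpe.integral_inner_pow_four`). With `y = x - m`, using the directions `eᵢ ± eⱼ` to polarize
gives `E yᵢyⱼ² = 0` and `E yᵢ²yⱼ² = (K / 3) (ΣᵢᵢΣⱼⱼ + 2 Σᵢⱼ²)`, with no differentiation
of `ψ`.

*Influence function.* With `z = diag(σ⁻¹) y`, the Sharpe ratio of asset `i` has the influence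
function `zᵢ - (ζᵢ / 2) (zᵢ² - 1)`. By the moment identities its covariance matrix is `V`
(`Sharpe.integral_influence_mul`), which is therefore positive semidefinite.

*Limit law.* The scaled sums of the influence function converge to `N(0, V)` by the multivariate
central limit theorem (`Sharpe.tendstoInDistribution_inv_sqrt_smul_sum`), which follows from the
one-dimensional one by Lévy's theorem. The difference between these sums and `√n (ζ̂ - ζ)` is, by an
exact identity, a sum of products of a sequence converging in distribution and a sequence tending
to `0` almost surely, so it is negligible (`Sharpe.tendstoInMeasure_sharpe_remainder`).

*Diagonal.* Since the skewness vanishes and `R` has unit diagonal, `Vᵢᵢ` is the variance of Mertens.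
-/

namespace Sharpe

/-! ### Convergence in distribution -/

section Convergence

variable {Ω : Type*} [MeasurableSpace Ω] {P : Measure Ω}

/-- Convergence in probability in `ℝᵖ` may be checked coordinatewise. -/
lemma tendstoInMeasure_euclideanSpace {ι : Type*} [Fintype ι]
    {D : ℕ → Ω → EuclideanSpace ℝ ι}
    (h : ∀ i, TendstoInMeasure P (fun n ω ↦ D n ω i) atTop 0) :
    TendstoInMeasure P D atTop 0 := by
  rw [tendstoInMeasure_iff_norm]
  intro ε hε
  set δ : ℝ := ε / (Fintype.card ι + 1)
  have hδ : 0 < δ := by positivity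
  have hsum : Tendsto (fun n ↦ ∑ i, P {ω | δ ≤ ‖D n ω i - (0 : Ω → ℝ) ω‖}) atTop (𝓝 0) := by
    have := tendsto_finsetSum Finset.univ fun i _ ↦ tendstoInMeasure_iff_norm.1 (h i) δ hδ
    simpa using this
  refine tendsto_of_tendsto_of_tendsto_of_le_of_le tendsto_const_nhds hsum (fun _ ↦ zero_le)
    fun n ↦ ?_
  refine le_trans (measure_mono ?_) (measure_biUnion_finset_le _ _)
  intro ω hω
  simp only [Set.mem_ofPred_eq, Pi.zero_apply, sub_zero, Set.mem_iUnion, Finset.mem_univ,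
    exists_prop, true_and] at hω ⊢
  by_contra! hlt
  have h1 : ‖D n ω‖ ≤ ∑ i, ‖D n ω i‖ := by
    conv_lhs => rw [← (EuclideanSpace.basisFun ι ℝ).sum_repr (D n ω)]
    refine (norm_sum_le _ _).trans (Finset.sum_le_sum fun i _ ↦ ?_)
    simp [norm_smul]
  have h2 : ∑ i, ‖D n ω i‖ ≤ ∑ _i : ι, δ := Finset.sum_le_sum fun i _ ↦ (hlt i).le
  have h3 : ∑ _i : ι, δ < ε := by
    simp only [Finset.sum_const, Finset.card_univ, nsmul_eq_mul, δ]
    rw [mul_div_assoc', div_lt_iff₀ (by positivity)]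
    nlinarith
  linarith

variable [IsProbabilityMeasure P]

/-- By the portmanteau theorem for the closed sets `{x | ε ≤ |x|}`, convergence in distribution to
`0` is convergence in probability. -/
lemma tendstoInMeasure_of_tendstoInDistribution_zero {Ω' : Type*} [MeasurableSpace Ω']
    {P' : Measure Ω'} [IsProbabilityMeasure P'] {Y : ℕ → Ω → ℝ}
    (h : TendstoInDistribution Y atTop (fun _ : Ω' ↦ (0 : ℝ)) (fun _ ↦ P) P') :
    TendstoInMeasure P Y atTop 0 := by
  rw [tendstoInMeasure_iff_norm]
  intro ε hε
  have hF : IsClosed {x : ℝ | ε ≤ ‖x‖} := isClosed_le continuous_const continuous_norm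
  have key := ProbabilityMeasure.limsup_measure_closed_le_of_tendsto h.tendsto hF
  have e0 : (P'.map fun _ ↦ (0 : ℝ)) {x : ℝ | ε ≤ ‖x‖} = 0 := by
    rw [Measure.map_apply (by fun_prop) hF.measurableSet]
    simp [hε.not_ge]
  have e1 (n : ℕ) : (P.map (Y n)) {x : ℝ | ε ≤ ‖x‖} = P {ω | ε ≤ ‖Y n ω - (0 : Ω → ℝ) ω‖} := by
    rw [Measure.map_apply_of_aemeasurable (h.forall_aemeasurable n) hF.measurableSet]
    simp
  simp only [ProbabilityMeasure.coe_mk, e0, e1] at key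
  exact tendsto_of_le_liminf_of_limsup_le zero_le key

/-- A sequence converging in distribution is bounded in probability, so its product with a sequence
tending to `0` almost surely tends to `0` in probability. -/
lemma tendstoInMeasure_mul_of_tendstoInDistribution {Ω' : Type*} [MeasurableSpace Ω']
    {P' : Measure Ω'} [IsProbabilityMeasure P'] {A c : ℕ → Ω → ℝ} {Z : Ω' → ℝ}
    (hA : TendstoInDistribution A atTop Z (fun _ ↦ P) P') (hcm : ∀ n, AEMeasurable (c n) P)
    (hc : ∀ᵐ ω ∂P, Tendsto (fun n ↦ c n ω) atTop (𝓝 0)) :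
    TendstoInMeasure P (fun n ω ↦ A n ω * c n ω) atTop 0 := by
  have hc' : TendstoInMeasure P c atTop (fun _ ↦ (0 : ℝ)) :=
    tendstoInMeasure_of_tendsto_ae (fun n ↦ (hcm n).aestronglyMeasurable) hc
  have := hA.continuous_comp_prodMk_of_tendstoInMeasure_const
    (g := fun q : ℝ × ℝ ↦ q.1 * q.2) (by fun_prop) hc' hcm
  simp only [mul_zero] at this
  exact tendstoInMeasure_of_tendstoInDistribution_zero this

end Convergence

/-! ### The multivariate central limit theorem -/

section CLT

variable {Ω : Type*} [MeasurableSpace Ω] {P : Measure Ω} {ι : Type*} [Fintype ι]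

lemma integral_inner_sq_eq {Y : Ω → EuclideanSpace ℝ ι} {S : Matrix ι ι ℝ}
    (hY : ∀ i, MemLp (fun ω ↦ Y ω i) 2 P) (hS : ∀ i j, S i j = ∫ ω, Y ω i * Y ω j ∂P)
    (t : EuclideanSpace ℝ ι) :
    ∫ ω, (inner ℝ (Y ω) t : ℝ) ^ 2 ∂P = t ⬝ᵥ S *ᵥ t := by
  have e (ω : Ω) : (inner ℝ (Y ω) t : ℝ) ^ 2 = ∑ i, ∑ j, (t i * t j) * (Y ω i * Y ω j) := by
    simp only [PiLp.inner_apply, RCLike.inner_apply, conj_trivial, sq, Finset.sum_mul_sum]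
    exact Finset.sum_congr rfl fun i _ ↦ Finset.sum_congr rfl fun j _ ↦ by ring
  have hint (i j : ι) : Integrable (fun ω ↦ (t i * t j) * (Y ω i * Y ω j)) P :=
    ((hY i).integrable_mul (hY j)).const_mul _
  simp_rw [e]
  rw [integral_finsetSum _ fun i _ ↦ integrable_finsetSum _ fun j _ ↦ hint i j]
  simp only [dotProduct, Matrix.mulVec, Finset.mul_sum]
  refine Finset.sum_congr rfl fun i _ ↦ ?_
  rw [integral_finsetSum _ fun j _ ↦ hint i j]
  refine Finset.sum_congr rfl fun j _ ↦ ?_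
  rw [integral_const_mul, hS]
  ring

lemma posSemidef_of_eq_integral_mul {Y : Ω → EuclideanSpace ℝ ι} {S : Matrix ι ι ℝ}
    (hY : ∀ i, MemLp (fun ω ↦ Y ω i) 2 P) (hS : ∀ i j, S i j = ∫ ω, Y ω i * Y ω j ∂P) :
    S.PosSemidef := by
  refine Matrix.PosSemidef.of_dotProduct_mulVec_nonneg ?_ fun t ↦ ?_
  · ext i j
    simp [hS, mul_comm]
  · have := integral_inner_sq_eq hY hS (WithLp.toLp 2 t)
    simp only [star_trivial]
    rw [← this]
    exact integral_nonneg fun _ ↦ sq_nonneg _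

/-- **Multivariate central limit theorem** for centred square-integrable vectors. By Lévy's theorem
it is enough to compare characteristic functions, and at `t` these are the characteristic functions
at `1` of the projections on `t`, to which the one-dimensional theorem applies. -/
theorem tendstoInDistribution_inv_sqrt_smul_sum [DecidableEq ι] [IsProbabilityMeasure P]
    {Y : ℕ → Ω → EuclideanSpace ℝ ι} {S : Matrix ι ι ℝ}
    (hY : ∀ i, MemLp (fun ω ↦ Y 0 ω i) 2 P) (h0 : ∀ i, ∫ ω, Y 0 ω i ∂P = 0)
    (hS : ∀ i j, S i j = ∫ ω, Y 0 ω i * Y 0 ω j ∂P)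
    (hindep : iIndepFun Y P) (hident : ∀ k, IdentDistrib (Y k) (Y 0) P P) :
    TendstoInDistribution (fun (n : ℕ) ω ↦ (√(n : ℝ))⁻¹ • ∑ k ∈ Finset.range n, Y k ω) atTop
      (id : EuclideanSpace ℝ ι → EuclideanSpace ℝ ι) (fun _ ↦ P) (multivariateGaussian 0 S) := by
  have hmeas (n : ℕ) :
      AEMeasurable (fun ω ↦ (√(n : ℝ))⁻¹ • ∑ k ∈ Finset.range n, Y k ω) P :=
    (Finset.aemeasurable_fun_sum _ fun k _ ↦ (hident k).aemeasurable_fst).const_smul ((√(n : ℝ))⁻¹)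
  refine ⟨hmeas, aemeasurable_id, ProbabilityMeasure.tendsto_iff_tendsto_charFun.2 fun t ↦ ?_⟩
  have hproj : Measurable fun y : EuclideanSpace ℝ ι ↦ (inner ℝ y t : ℝ) := by fun_prop
  have hmem : MemLp (fun ω ↦ (inner ℝ (Y 0 ω) t : ℝ)) 2 P := by
    have : (fun ω ↦ (inner ℝ (Y 0 ω) t : ℝ)) = fun ω ↦ ∑ i, t i * Y 0 ω i := by
      ext ω
      simp [PiLp.inner_apply]
    rw [this]
    exact memLp_finsetSum _ fun i _ ↦ (hY i).const_mul _
  have hmean : ∫ ω, (inner ℝ (Y 0 ω) t : ℝ) ∂P = 0 := by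
    simp only [PiLp.inner_apply, RCLike.inner_apply, conj_trivial]
    rw [integral_finsetSum _ fun i _ ↦ ((hY i).integrable (by norm_num)).const_mul _]
    simp [integral_const_mul, h0]
  have hVar : Var[fun ω ↦ (inner ℝ (Y 0 ω) t : ℝ); P] = t ⬝ᵥ S *ᵥ t := by
    rw [variance_of_integral_eq_zero hmem.aemeasurable hmean, ← integral_inner_sq_eq hY hS t]
  have hclt := tendstoInDistribution_inv_sqrt_mul_sum_sub
    (X := fun k ω ↦ (inner ℝ (Y k ω) t : ℝ)) (P := P)
    (Y := id) (P' := gaussianReal 0 Var[fun ω ↦ (inner ℝ (Y 0 ω) t : ℝ); P].toNNReal)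
    HasLaw.id hmem (hindep.comp (fun _ y ↦ (inner ℝ y t : ℝ)) fun _ ↦ hproj)
    (fun k ↦ (hident k).comp hproj)
  have hlim := ProbabilityMeasure.tendsto_iff_tendsto_charFun.1 hclt.tendsto 1
  have hV : 0 ≤ t ⬝ᵥ S *ᵥ t := hVar ▸ variance_nonneg _ _
  simp only [ProbabilityMeasure.coe_mk, Measure.map_id, hmean, mul_zero, sub_zero] at hlim ⊢
  rw [charFun_multivariateGaussian (posSemidef_of_eq_integral_mul hY hS)]
  rw [charFun_gaussianReal, hVar] at hlim
  convert hlim using 1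
  · ext n
    rw [charFun_apply, charFun_apply, integral_map (hmeas n) (by fun_prop),
      integral_map (by simpa only [hmean, mul_zero, sub_zero] using hclt.forall_aemeasurable n)
        (by fun_prop)]
    refine integral_congr_ae (.of_forall fun ω ↦ ?_)
    simp [real_inner_smul_left, sum_inner]
  · simp [hV]

end CLT

/-! ### Moments of elliptical laws -/

section Elliptical

variable {p : ℕ} {ν : Measure (EuclideanSpace ℝ (Fin p))}

lemma charFun_map_inner_sub {m : EuclideanSpace ℝ (Fin p)} {S : Matrix (Fin p) (Fin p) ℝ}
    {ψ : ℝ → ℂ}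
    (hψ : ∀ t : EuclideanSpace ℝ (Fin p),
      charFun ν t = Complex.exp ((inner ℝ t m : ℝ) * Complex.I) * ψ (t ⬝ᵥ S *ᵥ t))
    (a : EuclideanSpace ℝ (Fin p)) (s : ℝ) :
    charFun (ν.map fun x ↦ (inner ℝ (x - m) a : ℝ)) s = ψ (s ^ 2 * (a ⬝ᵥ S *ᵥ a)) := by
  have e : ψ (s ^ 2 * (a ⬝ᵥ S *ᵥ a)) =
      Complex.exp (-(inner ℝ (s • a) m : ℝ) * Complex.I) * charFun ν (s • a) := by
    rw [hψ, ← mul_assoc, ← Complex.exp_add]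
    have : ((s • a : EuclideanSpace ℝ (Fin p)) ⬝ᵥ S *ᵥ (s • a : EuclideanSpace ℝ (Fin p))) =
        s ^ 2 * (a ⬝ᵥ S *ᵥ a) := by
      rw [WithLp.ofLp_smul, Matrix.mulVec_smul, smul_dotProduct, dotProduct_smul]
      simp only [smul_eq_mul]
      ring
    rw [this]
    simp
  rw [e, charFun_apply, charFun_apply, integral_map (by fun_prop) (by fun_prop),
    ← integral_const_mul]
  refine integral_congr_ae (.of_forall fun x ↦ ?_)
  simp only [← Complex.exp_add]
  congr 1
  simp only [inner_sub_left, real_inner_smul_right, real_inner_smul_left, RCLike.inner_apply,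
    conj_trivial, real_inner_comm m a]
  push_cast
  ring

/-- The law of a centred projection of an elliptical vector depends on the direction `a` only
through `aᵀ S a`, up to the corresponding scaling. -/
lemma map_inner_sub_eq [IsProbabilityMeasure ν]
    {m : EuclideanSpace ℝ (Fin p)} {S : Matrix (Fin p) (Fin p) ℝ} {ψ : ℝ → ℂ}
    (hψ : ∀ t : EuclideanSpace ℝ (Fin p),
      charFun ν t = Complex.exp ((inner ℝ t m : ℝ) * Complex.I) * ψ (t ⬝ᵥ S *ᵥ t))
    {a b : EuclideanSpace ℝ (Fin p)} {c : ℝ} (hc : b ⬝ᵥ S *ᵥ b = c ^ 2 * (a ⬝ᵥ S *ᵥ a)) :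
    ν.map (fun x ↦ (inner ℝ (x - m) b : ℝ)) = ν.map (fun x ↦ c * (inner ℝ (x - m) a : ℝ)) := by
  have := Measure.isProbabilityMeasure_map (μ := ν)
    (f := fun x ↦ (inner ℝ (x - m) b : ℝ)) (by fun_prop)
  have := Measure.isProbabilityMeasure_map (μ := ν)
    (f := fun x ↦ c * (inner ℝ (x - m) a : ℝ)) (by fun_prop)
  refine Measure.ext_of_charFun (funext fun s ↦ ?_)
  rw [charFun_map_mul_comp (by fun_prop), charFun_map_inner_sub hψ, charFun_map_inner_sub hψ, hc]
  congr 1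
  ring

lemma integral_inner_sub_pow_eq [IsProbabilityMeasure ν]
    {m : EuclideanSpace ℝ (Fin p)} {S : Matrix (Fin p) (Fin p) ℝ} {ψ : ℝ → ℂ}
    (hψ : ∀ t : EuclideanSpace ℝ (Fin p),
      charFun ν t = Complex.exp ((inner ℝ t m : ℝ) * Complex.I) * ψ (t ⬝ᵥ S *ᵥ t))
    {a b : EuclideanSpace ℝ (Fin p)} {c : ℝ} (hc : b ⬝ᵥ S *ᵥ b = c ^ 2 * (a ⬝ᵥ S *ᵥ a)) (k : ℕ) :
    ∫ x, (inner ℝ (x - m) b : ℝ) ^ k ∂ν = c ^ k * ∫ x, (inner ℝ (x - m) a : ℝ) ^ k ∂ν := by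
  have h1 := integral_map (μ := ν) (φ := fun x ↦ (inner ℝ (x - m) b : ℝ)) (by fun_prop)
    (f := fun y : ℝ ↦ y ^ k) (by fun_prop)
  have h2 := integral_map (μ := ν) (φ := fun x ↦ c * (inner ℝ (x - m) a : ℝ)) (by fun_prop)
    (f := fun y : ℝ ↦ y ^ k) (by fun_prop)
  rw [map_inner_sub_eq hψ hc, h2] at h1
  rw [← h1]
  simp_rw [mul_pow]
  rw [integral_const_mul]

/-- Taking `b = a` and `c = -1` in `integral_inner_sub_pow_eq`. -/
lemma integral_inner_sub_pow_of_odd [IsProbabilityMeasure ν]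
    {m : EuclideanSpace ℝ (Fin p)} {S : Matrix (Fin p) (Fin p) ℝ} {ψ : ℝ → ℂ}
    (hψ : ∀ t : EuclideanSpace ℝ (Fin p),
      charFun ν t = Complex.exp ((inner ℝ t m : ℝ) * Complex.I) * ψ (t ⬝ᵥ S *ᵥ t))
    (a : EuclideanSpace ℝ (Fin p)) {k : ℕ} (hk : Odd k) :
    ∫ x, (inner ℝ (x - m) a : ℝ) ^ k ∂ν = 0 := by
  have := integral_inner_sub_pow_eq hψ (a := a) (b := a) (c := -1) (by ring) k
  rw [hk.neg_one_pow] at this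
  linarith

lemma memLp_eval (hmom : MemLp id 4 ν) (i : Fin p) : MemLp (fun x ↦ x i) 4 ν := by
  refine hmom.mono (by fun_prop) (.of_forall fun x ↦ ?_)
  exact PiLp.norm_apply_le x i

lemma integral_centred_sq (i : Fin p) : ∫ x, (x i - popMean ν i) ^ 2 ∂ν = popCov ν i i := by
  simp [popCov, sq]

lemma popSigma_pos {i : Fin p} (hi : 0 < popCov ν i i) : 0 < popSigma ν i := Real.sqrt_pos.2 hi

lemma popSigma_sq {i : Fin p} (hi : 0 < popCov ν i i) : popSigma ν i ^ 2 = popCov ν i i :=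
  Real.sq_sqrt hi.le

variable [IsProbabilityMeasure ν]

lemma memLp_centred (hmom : MemLp id 4 ν) (i : Fin p) :
    MemLp (fun x ↦ x i - popMean ν i) 4 ν :=
  (memLp_eval hmom i).sub (memLp_const _)

lemma memLp_centred_two (hmom : MemLp id 4 ν) (i : Fin p) :
    MemLp (fun x ↦ x i - popMean ν i) 2 ν :=
  (memLp_centred hmom i).mono_exponent (by norm_num)

lemma memLp_centred_mul (hmom : MemLp id 4 ν) (i j : Fin p) :
    MemLp (fun x ↦ (x i - popMean ν i) * (x j - popMean ν j)) 2 ν := by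
  have : ENNReal.HolderTriple 4 4 2 := ⟨by
    rw [← two_mul, show (4 : ENNReal) = 2 * 2 by norm_num, ENNReal.mul_inv (by simp) (by simp),
      ← mul_assoc, ENNReal.mul_inv_cancel (by simp) (by simp), one_mul]⟩
  exact (memLp_centred hmom j).mul (memLp_centred hmom i)

lemma integral_centred (hmom : MemLp id 4 ν) (i : Fin p) :
    ∫ x, (x i - popMean ν i) ∂ν = 0 := by
  rw [integral_sub ((memLp_eval hmom i).integrable (by norm_num)) (integrable_const _)]
  simp [popMean]

/-- The location `m` of an elliptical law is its mean. -/
lemma eval_eq_popMean {m : EuclideanSpace ℝ (Fin p)} {S : Matrix (Fin p) (Fin p) ℝ} {ψ : ℝ → ℂ}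
    (hmom : MemLp id 4 ν)
    (hψ : ∀ t : EuclideanSpace ℝ (Fin p),
      charFun ν t = Complex.exp ((inner ℝ t m : ℝ) * Complex.I) * ψ (t ⬝ᵥ S *ᵥ t))
    (i : Fin p) : m i = popMean ν i := by
  have := integral_inner_sub_pow_of_odd hψ (EuclideanSpace.single i 1) (k := 1) (by decide)
  simp only [EuclideanSpace.inner_single_right, PiLp.sub_apply, conj_trivial, one_mul,
    pow_one] at this
  rw [integral_sub ((memLp_eval hmom i).integrable (by norm_num)) (integrable_const _)] at this
  simp only [integral_const, probReal_univ, smul_eq_mul, one_mul] at this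
  rw [popMean]
  linarith

/-- The projections of a centred elliptical vector all have the kurtosis of the `i`-th marginal,
being scaled copies of it in law. -/
lemma integral_inner_pow_four {m : EuclideanSpace ℝ (Fin p)} {S : Matrix (Fin p) (Fin p) ℝ}
    {ψ : ℝ → ℂ} (hmom : MemLp id 4 ν) (hS : S.PosSemidef)
    (hψ : ∀ t : EuclideanSpace ℝ (Fin p),
      charFun ν t = Complex.exp ((inner ℝ t m : ℝ) * Complex.I) * ψ (t ⬝ᵥ S *ᵥ t))
    {i : Fin p} (hi : 0 < popCov ν i i) (a : EuclideanSpace ℝ (Fin p)) :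
    ∫ x, (inner ℝ (x - m) a : ℝ) ^ 4 ∂ν =
      popKurt ν i * (∫ x, (inner ℝ (x - m) a : ℝ) ^ 2 ∂ν) ^ 2 := by
  set e : EuclideanSpace ℝ (Fin p) := EuclideanSpace.single i 1 with he
  have hq (b : EuclideanSpace ℝ (Fin p)) : 0 ≤ b ⬝ᵥ S *ᵥ b := by
    simpa using hS.dotProduct_mulVec_nonneg b.ofLp
  have hproj (x : EuclideanSpace ℝ (Fin p)) : (inner ℝ (x - m) e : ℝ) = x i - popMean ν i := by
    simp [he, EuclideanSpace.inner_single_right, eval_eq_popMean hmom hψ]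
  have h2 : ∫ x, (inner ℝ (x - m) e : ℝ) ^ 2 ∂ν = popCov ν i i := by
    simp_rw [hproj, integral_centred_sq]
  have hqe : 0 < e ⬝ᵥ S *ᵥ e := by
    refine (hq e).lt_of_ne fun h ↦ hi.ne' ?_
    -- a direction of zero scatter is a scaling by `0`, so the projection would vanish
    rw [← h2, integral_inner_sub_pow_eq hψ (a := e) (b := e) (c := 0) (by rw [← h]; ring)]
    simp
  have hc : a ⬝ᵥ S *ᵥ a = √((a ⬝ᵥ S *ᵥ a) / (e ⬝ᵥ S *ᵥ e)) ^ 2 * (e ⬝ᵥ S *ᵥ e) := by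
    rw [Real.sq_sqrt (div_nonneg (hq a) hqe.le)]
    field_simp
  rw [integral_inner_sub_pow_eq hψ hc 4, integral_inner_sub_pow_eq hψ hc 2, h2, popKurt, popSigma]
  simp_rw [hproj]
  rw [show √(popCov ν i i) ^ 4 = popCov ν i i ^ 2 by
    rw [show (4 : ℕ) = 2 * 2 from rfl, pow_mul, Real.sq_sqrt hi.le]]
  field_simp

/-- All marginals of an elliptical law have the same kurtosis. -/
lemma popKurt_eq (hell : IsElliptical ν) (hmom : MemLp id 4 ν)
    (hvar : ∀ i, 0 < popCov ν i i) (i j : Fin p) : popKurt ν i = popKurt ν j := by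
  obtain ⟨m, S, ψ, hS, hψ⟩ := hell
  have h := integral_inner_pow_four hmom hS hψ (hvar j) (EuclideanSpace.single i 1)
  simp only [EuclideanSpace.inner_single_right, PiLp.sub_apply, conj_trivial, one_mul,
    eval_eq_popMean hmom hψ, integral_centred_sq] at h
  rw [popKurt, h, ← popSigma_sq (hvar i)]
  have := popSigma_pos (hvar i)
  field_simp

/-- Mixed third moments vanish, by polarization of the vanishing third moments of projections. -/
lemma integral_mul_sq_eq_zero (hell : IsElliptical ν) (hmom : MemLp id 4 ν) (i j : Fin p) :
    ∫ x, (x i - popMean ν i) * (x j - popMean ν j) ^ 2 ∂ν = 0 := by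
  obtain ⟨m, S, ψ, hS, hψ⟩ := hell
  have h (a) := integral_inner_sub_pow_of_odd hψ a (k := 3) (by decide)
  have h1 := h (EuclideanSpace.single i 1)
  have h2 := h (EuclideanSpace.single i 1 + EuclideanSpace.single j 1)
  have h3 := h (EuclideanSpace.single i 1 - EuclideanSpace.single j 1)
  simp only [inner_add_right, inner_sub_right, EuclideanSpace.inner_single_right, PiLp.sub_apply,
    conj_trivial, one_mul, eval_eq_popMean hmom hψ] at h1 h2 h3
  have I (k l n : Fin p) : Integrable
      (fun x ↦ (x k - popMean ν k) * ((x l - popMean ν l) * (x n - popMean ν n))) ν :=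
    (memLp_centred_two hmom k).integrable_mul (memLp_centred_mul hmom l n)
  have e2 := integral_add ((I i i i).add ((I i i j).const_mul 3))
    (((I i j j).const_mul 3).add (I j j j))
  have e3 := integral_add ((I i i i).sub ((I i i j).const_mul 3))
    (((I i j j).const_mul 3).sub (I j j j))
  simp only [Pi.add_apply, Pi.sub_apply] at e2 e3
  rw [integral_add (I i i i) ((I i i j).const_mul 3),
    integral_add ((I i j j).const_mul 3) (I j j j), integral_const_mul, integral_const_mul] at e2
  rw [integral_sub (I i i i) ((I i i j).const_mul 3),
    integral_sub ((I i j j).const_mul 3) (I j j j), integral_const_mul, integral_const_mul] at e3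
  have g1 : ∫ x, (x i - popMean ν i) * ((x i - popMean ν i) * (x i - popMean ν i)) ∂ν = 0 := by
    rw [← h1]; congr with x; ring
  have g : ∫ x, (x i - popMean ν i) * (x j - popMean ν j) ^ 2 ∂ν =
      ∫ x, (x i - popMean ν i) * ((x j - popMean ν j) * (x j - popMean ν j)) ∂ν := by
    congr with x; ring
  have g2 := e2.symm.trans (Eq.trans (by congr with x; ring) h2)
  have g3 := e3.symm.trans (Eq.trans (by congr with x; ring) h3)
  rw [g]
  linarith

/-- Mixed fourth moments, by polarization of the fourth moments of projections. -/
lemma integral_sq_mul_sq (hell : IsElliptical ν) (hmom : MemLp id 4 ν)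
    (hvar : ∀ i, 0 < popCov ν i i) (i j : Fin p) :
    ∫ x, (x i - popMean ν i) ^ 2 * (x j - popMean ν j) ^ 2 ∂ν =
      popKurt ν i / 3 * (popCov ν i i * popCov ν j j + 2 * popCov ν i j ^ 2) := by
  obtain ⟨m, S, ψ, hS, hψ⟩ := hell
  have h (a) := integral_inner_pow_four hmom hS hψ (hvar i) a
  have h1 := h (EuclideanSpace.single i 1)
  have h1' := h (EuclideanSpace.single j 1)
  have h2 := h (EuclideanSpace.single i 1 + EuclideanSpace.single j 1)
  have h3 := h (EuclideanSpace.single i 1 - EuclideanSpace.single j 1)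
  simp only [inner_add_right, inner_sub_right, EuclideanSpace.inner_single_right, PiLp.sub_apply,
    conj_trivial, one_mul, eval_eq_popMean hmom hψ, integral_centred_sq] at h1 h1' h2 h3
  have J (k l : Fin p) : Integrable (fun x ↦ (x k - popMean ν k) * (x l - popMean ν l)) ν :=
    (memLp_centred_two hmom k).integrable_mul (memLp_centred_two hmom l)
  have I (k l n o : Fin p) : Integrable (fun x ↦ ((x k - popMean ν k) * (x l - popMean ν l)) *
      ((x n - popMean ν n) * (x o - popMean ν o))) ν :=
    (memLp_centred_mul hmom k l).integrable_mul (memLp_centred_mul hmom n o)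
  have q2 : ∫ x, (x i - popMean ν i + (x j - popMean ν j)) ^ 2 ∂ν =
      popCov ν i i + 2 * popCov ν i j + popCov ν j j := by
    simp only [popCov, Matrix.of_apply]
    rw [← integral_const_mul, ← integral_add (J i i) ((J i j).const_mul 2),
      ← integral_add ((J i i).fun_add ((J i j).const_mul 2)) (J j j)]
    congr with x
    ring
  have q3 : ∫ x, (x i - popMean ν i - (x j - popMean ν j)) ^ 2 ∂ν =
      popCov ν i i + -2 * popCov ν i j + popCov ν j j := by
    simp only [popCov, Matrix.of_apply]
    rw [← integral_const_mul, ← integral_add (J i i) ((J i j).const_mul (-2)),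
      ← integral_add ((J i i).fun_add ((J i j).const_mul (-2))) (J j j)]
    congr with x
    ring
  rw [q2] at h2
  rw [q3] at h3
  have P2 : Integrable (fun x ↦ (x i - popMean ν i + (x j - popMean ν j)) ^ 4) ν := by
    refine (((((I i i i i).add ((I i i i j).const_mul 4)).add ((I i i j j).const_mul 6)).add
      ((I i j j j).const_mul 4)).add (I j j j j)).congr (.of_forall fun x ↦ ?_)
    simp only [Pi.add_apply]
    ring
  have P3 : Integrable (fun x ↦ (x i - popMean ν i - (x j - popMean ν j)) ^ 4) ν := by
    refine (((((I i i i i).sub ((I i i i j).const_mul 4)).add ((I i i j j).const_mul 6)).sub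
      ((I i j j j).const_mul 4)).add (I j j j j)).congr (.of_forall fun x ↦ ?_)
    simp only [Pi.add_apply, Pi.sub_apply]
    ring
  have Q (k : Fin p) : Integrable (fun x ↦ (x k - popMean ν k) ^ 4) ν :=
    (I k k k k).congr (.of_forall fun x ↦ by ring)
  have R : ∫ x, (x i - popMean ν i) ^ 2 * (x j - popMean ν j) ^ 2 ∂ν =
      (1 / 12) * (∫ x, (x i - popMean ν i + (x j - popMean ν j)) ^ 4 ∂ν +
        ∫ x, (x i - popMean ν i - (x j - popMean ν j)) ^ 4 ∂ν -
        2 * (∫ x, (x i - popMean ν i) ^ 4 ∂ν + ∫ x, (x j - popMean ν j) ^ 4 ∂ν)) := by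
    rw [← integral_add (Q i) (Q j), ← integral_add P2 P3, ← integral_const_mul,
      ← integral_sub (P2.fun_add P3) (((Q i).fun_add (Q j)).const_mul 2), ← integral_const_mul]
    congr with x
    ring
  rw [R, h1, h1', h2, h3]
  ring

lemma popSkew_eq_zero (hell : IsElliptical ν) (hmom : MemLp id 4 ν) (i : Fin p) :
    popSkew ν i = 0 := by
  have := integral_mul_sq_eq_zero hell hmom i i
  rw [popSkew, show ∫ x, (x i - popMean ν i) ^ 3 ∂ν = 0 from ?_, zero_div]
  rw [← this]
  congr with x
  ring

end Elliptical

/-! ### The influence function of the Sharpe ratios -/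

section Influence

variable {p : ℕ} {ν : Measure (EuclideanSpace ℝ (Fin p))}

/-- The influence function of the vector of Sharpe ratios at the law `ν`: with
`z i = (x i - μ i) / σ i`, its coordinates are `z i - (ζ i / 2) * (z i ^ 2 - 1)`. It is the
derivative of `(mean, variance) ↦ (mean - r) / √variance` at `(μ i, σ i ^ 2)`, applied to
`(x i - μ i, (x i - μ i) ^ 2 - σ i ^ 2)`. -/
noncomputable def influence (ν : Measure (EuclideanSpace ℝ (Fin p))) (r : ℝ)
    (x : EuclideanSpace ℝ (Fin p)) : EuclideanSpace ℝ (Fin p) :=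
  WithLp.toLp 2 fun i ↦ (x i - popMean ν i) / popSigma ν i -
    popSNR ν r i / 2 * (((x i - popMean ν i) / popSigma ν i) ^ 2 - 1)

lemma measurable_influence (r : ℝ) : Measurable (influence ν r) := by
  unfold influence
  fun_prop

lemma asympCov_apply (κ : ℝ) (R : Matrix (Fin p) (Fin p) ℝ) (ζ : Fin p → ℝ) (i j : Fin p) :
    asympCov κ R ζ i j =
      R i j + (κ - 1) / 4 * (ζ i * ζ j) + κ / 2 * (ζ i * R i j ^ 2 * ζ j) := by
  simp [asympCov, Matrix.vecMulVec_apply, Matrix.diagonal_mul, Matrix.mul_diagonal, sq]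

lemma popCorr_apply (i j : Fin p) :
    popCorr ν i j = popCov ν i j / (popSigma ν i * popSigma ν j) := by
  simp only [popCorr, Matrix.mul_diagonal, Matrix.diagonal_mul]
  rw [div_eq_mul_inv, mul_inv]
  ring

lemma popCorr_self {i : Fin p} (hi : 0 < popCov ν i i) : popCorr ν i i = 1 := by
  rw [popCorr_apply, ← sq, popSigma_sq hi, div_self hi.ne']

variable [IsProbabilityMeasure ν]

lemma popMom2_sub_sq (hmom : MemLp id 4 ν) (i : Fin p) :
    popMom2 ν i - popMean ν i ^ 2 = popCov ν i i := by
  have h1 : Integrable (fun x ↦ x i) ν := (memLp_eval hmom i).integrable (by norm_num)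
  have h2 : Integrable (fun x ↦ x i ^ 2) ν :=
    ((memLp_eval hmom i).mono_exponent (by norm_num : (2 : ENNReal) ≤ 4)).integrable_sq
  have e (x : EuclideanSpace ℝ (Fin p)) : (x i - popMean ν i) ^ 2 =
      x i ^ 2 + (-2 * popMean ν i) * x i + popMean ν i ^ 2 := by ring
  rw [← integral_centred_sq]
  simp_rw [e]
  rw [integral_add (h2.fun_add (h1.const_mul _)) (integrable_const _),
    integral_add h2 (h1.const_mul _), integral_const_mul, ← popMean, ← popMom2]
  simp only [integral_const, probReal_univ, one_smul]
  ring

lemma popSNR_apply (hmom : MemLp id 4 ν) (r : ℝ) (i : Fin p) :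
    popSNR ν r i = (popMean ν i - r) / popSigma ν i := by
  simp only [popSNR, popMom2_sub_sq hmom, popSigma]

lemma memLp_influence_quadratic (hmom : MemLp id 4 ν) (i : Fin p) :
    MemLp (fun x ↦ ((x i - popMean ν i) / popSigma ν i) ^ 2 - 1) 2 ν := by
  have := ((memLp_centred_mul hmom i i).const_mul ((popSigma ν i ^ 2)⁻¹)).sub
    (memLp_const (1 : ℝ))
  refine this.ae_eq (.of_forall fun x ↦ ?_)
  simp only [Pi.sub_apply]
  rw [div_pow, div_eq_inv_mul, sq (x i - popMean ν i)]

lemma memLp_influence_linear (hmom : MemLp id 4 ν) (i : Fin p) :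
    MemLp (fun x ↦ (x i - popMean ν i) / popSigma ν i) 2 ν :=
  ((memLp_centred_two hmom i).mul_const (popSigma ν i)⁻¹).ae_eq
    (.of_forall fun _ ↦ (div_eq_mul_inv _ _).symm)

lemma memLp_influence (hmom : MemLp id 4 ν) (r : ℝ) (i : Fin p) :
    MemLp (fun x ↦ influence ν r x i) 2 ν :=
  (memLp_influence_linear hmom i).sub ((memLp_influence_quadratic hmom i).const_mul _)

lemma integral_influence_quadratic (hmom : MemLp id 4 ν) {i : Fin p} (hi : 0 < popCov ν i i) :
    ∫ x, (((x i - popMean ν i) / popSigma ν i) ^ 2 - 1) ∂ν = 0 := by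
  rw [integral_sub (memLp_influence_linear hmom i).integrable_sq (integrable_const _)]
  simp_rw [div_pow]
  rw [integral_div, integral_centred_sq, popSigma_sq hi, div_self hi.ne']
  simp

lemma integral_influence (hmom : MemLp id 4 ν) (hvar : ∀ i, 0 < popCov ν i i) (r : ℝ)
    (i : Fin p) : ∫ x, influence ν r x i ∂ν = 0 := by
  simp only [influence]
  rw [integral_sub ((memLp_influence_linear hmom i).integrable (by norm_num))
    (((memLp_influence_quadratic hmom i).integrable (by norm_num)).const_mul _),
    integral_const_mul, integral_influence_quadratic hmom (hvar i), integral_div,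
    integral_centred hmom]
  simp

lemma integral_linear_mul_quadratic (hell : IsElliptical ν) (hmom : MemLp id 4 ν) (i j : Fin p) :
    ∫ x, ((x i - popMean ν i) / popSigma ν i) *
      (((x j - popMean ν j) / popSigma ν j) ^ 2 - 1) ∂ν = 0 := by
  have h1 : Integrable (fun x ↦ (x i - popMean ν i) * (x j - popMean ν j) ^ 2) ν :=
    ((memLp_centred_two hmom i).integrable_mul (memLp_centred_mul hmom j j)).congr
      (.of_forall fun x ↦ by simp only [Pi.mul_apply]; ring)
  have h2 : Integrable (fun x ↦ x i - popMean ν i) ν :=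
    (memLp_centred hmom i).integrable (by norm_num)
  have e (x : EuclideanSpace ℝ (Fin p)) : ((x i - popMean ν i) / popSigma ν i) *
      (((x j - popMean ν j) / popSigma ν j) ^ 2 - 1) =
      (popSigma ν i * popSigma ν j ^ 2)⁻¹ * ((x i - popMean ν i) * (x j - popMean ν j) ^ 2) -
      (popSigma ν i)⁻¹ * (x i - popMean ν i) := by
    rw [mul_inv]
    ring
  simp_rw [e]
  rw [integral_sub (h1.const_mul _) (h2.const_mul _), integral_const_mul, integral_const_mul,
    integral_mul_sq_eq_zero hell hmom, integral_centred hmom]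
  simp

lemma integral_quadratic_mul_quadratic (hell : IsElliptical ν) (hmom : MemLp id 4 ν)
    (hvar : ∀ i, 0 < popCov ν i i) (i j : Fin p) :
    ∫ x, (((x i - popMean ν i) / popSigma ν i) ^ 2 - 1) *
      (((x j - popMean ν j) / popSigma ν j) ^ 2 - 1) ∂ν =
      popKurt ν i / 3 * (1 + 2 * popCorr ν i j ^ 2) - 1 := by
  have h1 : Integrable (fun x ↦ (x i - popMean ν i) ^ 2 * (x j - popMean ν j) ^ 2) ν :=
    ((memLp_centred_mul hmom i i).integrable_mul (memLp_centred_mul hmom j j)).congr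
      (.of_forall fun x ↦ by simp only [Pi.mul_apply]; ring)
  have hq (k : Fin p) : Integrable (fun x ↦ ((x k - popMean ν k) / popSigma ν k) ^ 2 - 1) ν :=
    (memLp_influence_quadratic hmom k).integrable (by norm_num)
  have e (x : EuclideanSpace ℝ (Fin p)) : (((x i - popMean ν i) / popSigma ν i) ^ 2 - 1) *
      (((x j - popMean ν j) / popSigma ν j) ^ 2 - 1) =
      (popSigma ν i ^ 2 * popSigma ν j ^ 2)⁻¹ *
        ((x i - popMean ν i) ^ 2 * (x j - popMean ν j) ^ 2) +
      -1 * (((x i - popMean ν i) / popSigma ν i) ^ 2 - 1) +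
      -1 * (((x j - popMean ν j) / popSigma ν j) ^ 2 - 1) + -1 := by
    rw [mul_inv]
    ring
  simp_rw [e]
  rw [integral_add (((h1.const_mul _).fun_add ((hq i).const_mul _)).fun_add ((hq j).const_mul _))
      (integrable_const _),
    integral_add ((h1.const_mul _).fun_add ((hq i).const_mul _)) ((hq j).const_mul _),
    integral_add (h1.const_mul _) ((hq i).const_mul _), integral_const_mul (-1),
    integral_const_mul (-1), integral_influence_quadratic hmom (hvar i),
    integral_influence_quadratic hmom (hvar j),
    integral_const_mul, integral_sq_mul_sq hell hmom hvar, popCorr_apply, div_pow, mul_pow,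
    popSigma_sq (hvar i), popSigma_sq (hvar j)]
  have hi := (hvar i).ne'
  have hj := (hvar j).ne'
  simp only [integral_const, probReal_univ, one_smul]
  field_simp
  ring

/-- The covariance matrix of the influence function is the asserted asymptotic covariance. -/
lemma integral_influence_mul (hell : IsElliptical ν) (hmom : MemLp id 4 ν)
    (hvar : ∀ i, 0 < popCov ν i i) (r : ℝ) (i j : Fin p) :
    ∫ x, influence ν r x i * influence ν r x j ∂ν =
      asympCov (popKurt ν i / 3) (popCorr ν) (popSNR ν r) i j := by
  set f : Fin p → EuclideanSpace ℝ (Fin p) → ℝ :=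
    fun k x ↦ (x k - popMean ν k) / popSigma ν k
  set g : Fin p → EuclideanSpace ℝ (Fin p) → ℝ :=
    fun k x ↦ ((x k - popMean ν k) / popSigma ν k) ^ 2 - 1
  have hf (k) : MemLp (f k) 2 ν := memLp_influence_linear hmom k
  have hg (k) : MemLp (g k) 2 ν := memLp_influence_quadratic hmom k
  have Iff : Integrable (fun x ↦ f i x * f j x) ν := (hf i).integrable_mul (hf j)
  have Ifg : Integrable (fun x ↦ f i x * g j x) ν := (hf i).integrable_mul (hg j)
  have Igf : Integrable (fun x ↦ f j x * g i x) ν := (hf j).integrable_mul (hg i)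
  have Igg : Integrable (fun x ↦ g i x * g j x) ν := (hg i).integrable_mul (hg j)
  have Jfg : ∫ x, f i x * g j x ∂ν = 0 := integral_linear_mul_quadratic hell hmom i j
  have Jgf : ∫ x, f j x * g i x ∂ν = 0 := integral_linear_mul_quadratic hell hmom j i
  have Jgg := integral_quadratic_mul_quadratic hell hmom hvar i j
  have Jff : ∫ x, f i x * f j x ∂ν = popCorr ν i j := by
    simp only [f, popCorr_apply, popCov, Matrix.of_apply, div_mul_div_comm]
    rw [integral_div]
  have e (x : EuclideanSpace ℝ (Fin p)) : influence ν r x i * influence ν r x j =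
      f i x * f j x + -(popSNR ν r j / 2) * (f i x * g j x) +
      -(popSNR ν r i / 2) * (f j x * g i x) +
      (popSNR ν r i * popSNR ν r j / 4) * (g i x * g j x) := by
    simp only [influence, f, g]
    ring
  simp_rw [e]
  rw [integral_add ((Iff.fun_add (Ifg.const_mul _)).fun_add (Igf.const_mul _)) (Igg.const_mul _),
    integral_add (Iff.fun_add (Ifg.const_mul _)) (Igf.const_mul _),
    integral_add Iff (Ifg.const_mul _), integral_const_mul, integral_const_mul,
    integral_const_mul, Jff, Jfg, Jgf, Jgg, asympCov_apply]
  ring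

end Influence

/-! ### Linearization of the sample Sharpe ratio of one asset -/

section Linearization

variable {Ω : Type*} [MeasurableSpace Ω] {P : Measure Ω} [IsProbabilityMeasure P]

lemma tendstoInMeasure_add_zero {X Y : ℕ → Ω → ℝ} (hXm : ∀ n, AEMeasurable (X n) P)
    (hYm : ∀ n, AEMeasurable (Y n) P) (hX : TendstoInMeasure P X atTop 0)
    (hY : TendstoInMeasure P Y atTop 0) :
    TendstoInMeasure P (fun n ω ↦ X n ω + Y n ω) atTop 0 := by
  have h := (hX.tendstoInDistribution hXm).add_of_tendstoInMeasure_const (c := (0 : ℝ)) hY hYm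
  simp only [Pi.zero_apply, add_zero] at h
  exact tendstoInMeasure_of_tendstoInDistribution_zero h

/-- The exact remainder of the linearization, each summand being the product of a `√n`-scaled
centred average and a quantity that tends to `0`. Here `N` stands for `√n`, `M` for the centred
sample mean, `Q` for the sample mean of the squared deviations from the true mean, and `s` for the
sample standard deviation. -/
lemma sharpe_remainder_identity {N M Q d s σ : ℝ} (hσ : 0 < σ) (hs : 0 < s)
    (hsQ : s ^ 2 = Q - M ^ 2) :
    N * ((M + d) / s - d / σ) - (N * M / σ - d / σ / 2 * (N * (Q - σ ^ 2) / σ ^ 2)) =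
      N * M * (1 / s - 1 / σ + M * (d / (σ * s * (σ + s)))) +
      N * (Q - σ ^ 2) * (d / (2 * σ ^ 3) - d / (σ * s * (σ + s))) := by
  obtain rfl : Q = s ^ 2 + M ^ 2 := by linarith
  have : σ + s ≠ 0 := by positivity
  field_simp
  ring

/-- For independent copies of a real random variable with mean `μ` and variance `σ ^ 2`, the scaled
error of the sample Sharpe ratio is, up to a term that tends to `0` in probability, the scaled sum
of its influence function. -/
theorem tendstoInMeasure_sharpe_remainder {x : ℕ → Ω → ℝ} {μ σ : ℝ} (r : ℝ) (hσ : 0 < σ)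
    (hx : MemLp (fun ω ↦ x 0 ω - μ) 2 P) (hx2 : MemLp (fun ω ↦ (x 0 ω - μ) ^ 2) 2 P)
    (h1 : ∫ ω, (x 0 ω - μ) ∂P = 0) (h2 : ∫ ω, (x 0 ω - μ) ^ 2 ∂P = σ ^ 2)
    (hindep : iIndepFun x P) (hident : ∀ k, IdentDistrib (x k) (x 0) P P) :
    TendstoInMeasure P (fun (n : ℕ) ω ↦
      √(n : ℝ) * (((1 / (n : ℝ)) * ∑ k ∈ Finset.range n, x k ω - r) /
        √((1 / (n : ℝ)) * ∑ k ∈ Finset.range n, x k ω ^ 2 -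
          ((1 / (n : ℝ)) * ∑ k ∈ Finset.range n, x k ω) ^ 2) - (μ - r) / σ) -
      (√(n : ℝ))⁻¹ * ∑ k ∈ Finset.range n,
        ((x k ω - μ) / σ - (μ - r) / σ / 2 * (((x k ω - μ) / σ) ^ 2 - 1))) atTop 0 := by
  have mx (k) : AEMeasurable (x k) P := (hident k).aemeasurable_fst
  have g1 : Measurable fun y : ℝ ↦ y - μ := by fun_prop
  have g2 : Measurable fun y : ℝ ↦ (y - μ) ^ 2 := by fun_prop
  set M : ℕ → Ω → ℝ := fun n ω ↦ (n : ℝ)⁻¹ • ∑ k ∈ Finset.range n, (x k ω - μ) with hM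
  set Q : ℕ → Ω → ℝ := fun n ω ↦ (n : ℝ)⁻¹ • ∑ k ∈ Finset.range n, (x k ω - μ) ^ 2 with hQ
  set s : ℕ → Ω → ℝ := fun n ω ↦ √(Q n ω - M n ω ^ 2) with hs
  set d : ℝ := μ - r with hd
  -- strong laws
  have lM : ∀ᵐ ω ∂P, Tendsto (fun n ↦ M n ω) atTop (𝓝 0) := by
    have := strong_law_ae (fun k ω ↦ x k ω - μ) (hx.integrable (by norm_num))
      (fun i j hij ↦ (hindep.indepFun hij).comp g1 g1) (fun k ↦ (hident k).comp g1)
    rwa [h1] at this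
  have lQ : ∀ᵐ ω ∂P, Tendsto (fun n ↦ Q n ω) atTop (𝓝 (σ ^ 2)) := by
    have := strong_law_ae (fun k ω ↦ (x k ω - μ) ^ 2) (hx2.integrable (by norm_num))
      (fun i j hij ↦ (hindep.indepFun hij).comp g2 g2) (fun k ↦ (hident k).comp g2)
    rwa [h2] at this
  have ls : ∀ᵐ ω ∂P, Tendsto (fun n ↦ s n ω) atTop (𝓝 σ) := by
    filter_upwards [lM, lQ] with ω hMω hQω
    have := (hQω.sub (hMω.pow 2)).sqrt
    simpa [Real.sqrt_sq hσ.le] using this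
  -- central limit theorems
  have cM := tendstoInDistribution_inv_sqrt_mul_sum_sub (P := P) (X := fun k ω ↦ x k ω - μ)
    HasLaw.id hx (hindep.comp (fun _ y ↦ y - μ) fun _ ↦ g1) (fun k ↦ (hident k).comp g1)
  have cQ := tendstoInDistribution_inv_sqrt_mul_sum_sub (P := P) (X := fun k ω ↦ (x k ω - μ) ^ 2)
    HasLaw.id hx2 (hindep.comp (fun _ y ↦ (y - μ) ^ 2) fun _ ↦ g2) (fun k ↦ (hident k).comp g2)
  simp only [h1, h2, mul_zero, sub_zero] at cM cQ
  have mM (n) : AEMeasurable (M n) P :=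
    (Finset.aemeasurable_fun_sum _ fun k _ ↦ (mx k).sub_const μ).const_mul _
  have mQ (n) : AEMeasurable (Q n) P :=
    (Finset.aemeasurable_fun_sum _ fun k _ ↦ ((mx k).sub_const μ).pow_const 2).const_mul _
  have ms (n) : AEMeasurable (s n) P := ((mQ n).sub ((mM n).pow_const 2)).sqrt
  set c₁ : ℕ → Ω → ℝ :=
    fun n ω ↦ 1 / s n ω - 1 / σ + M n ω * (d / (σ * s n ω * (σ + s n ω))) with hc₁
  set c₂ : ℕ → Ω → ℝ :=
    fun n ω ↦ d / (2 * σ ^ 3) - d / (σ * s n ω * (σ + s n ω)) with hc₂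
  have mc₁ (n) : AEMeasurable (c₁ n) P := by fun_prop
  have mc₂ (n) : AEMeasurable (c₂ n) P := by fun_prop
  have hne : σ * σ * (σ + σ) ≠ 0 := by positivity
  have lc₁ : ∀ᵐ ω ∂P, Tendsto (fun n ↦ c₁ n ω) atTop (𝓝 0) := by
    filter_upwards [lM, ls] with ω hMω hsω
    have := (((tendsto_const_nhds (x := (1 : ℝ))).div hsω hσ.ne').sub_const (1 / σ)).add
      (hMω.mul ((tendsto_const_nhds (x := d)).div ((hsω.const_mul σ).mul (hsω.const_add σ)) hne))
    simpa [hc₁] using this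
  have lc₂ : ∀ᵐ ω ∂P, Tendsto (fun n ↦ c₂ n ω) atTop (𝓝 0) := by
    filter_upwards [ls] with ω hsω
    have := ((tendsto_const_nhds (x := d)).div
      ((hsω.const_mul σ).mul (hsω.const_add σ)) hne).const_sub (d / (2 * σ ^ 3))
    rwa [show σ * σ * (σ + σ) = 2 * σ ^ 3 by ring, sub_self] at this
  have t₁ := tendstoInMeasure_mul_of_tendstoInDistribution cM mc₁ lc₁
  have t₂ := tendstoInMeasure_mul_of_tendstoInDistribution cQ mc₂ lc₂
  have t := tendstoInMeasure_add_zero (fun n ↦ (cM.forall_aemeasurable n).mul (mc₁ n))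
    (fun n ↦ (cQ.forall_aemeasurable n).mul (mc₂ n)) t₁ t₂
  refine ((tendstoInMeasure_add_zero (fun n ↦ ?_) (fun n ↦ ?_) t
    (tendstoInMeasure_of_tendsto_ae (f := fun n ω ↦ _ - _) (fun n ↦ ?_) ?_)).congr_left
    fun n ↦ .of_forall fun ω ↦ add_sub_cancel _ _)
  · exact ((cM.forall_aemeasurable n).mul (mc₁ n)).add ((cQ.forall_aemeasurable n).mul (mc₂ n))
  · have := cM.forall_aemeasurable n
    have := cQ.forall_aemeasurable n
    fun_prop
  · have := cM.forall_aemeasurable n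
    have := cQ.forall_aemeasurable n
    exact AEMeasurable.aestronglyMeasurable (by fun_prop)
  -- the remainder identity can fail only where the sample variance is not positive
  filter_upwards [ls] with ω hsω
  refine tendsto_const_nhds.congr' ?_
  filter_upwards [hsω.eventually_const_lt hσ, eventually_gt_atTop 0] with n hpos hn
  have hn' : (0 : ℝ) < n := by exact_mod_cast hn
  have hN : √(n : ℝ) ≠ 0 := (Real.sqrt_pos.2 hn').ne'
  have hNN : √(n : ℝ) ^ 2 = n := Real.sq_sqrt hn'.le
  have hsq : s n ω ^ 2 = Q n ω - M n ω ^ 2 := Real.sq_sqrt (Real.sqrt_pos.1 hpos).le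
  have hmean : (1 / (n : ℝ)) * ∑ k ∈ Finset.range n, x k ω = M n ω + μ := by
    simp only [hM, Finset.sum_sub_distrib, Finset.sum_const, Finset.card_range, nsmul_eq_mul,
      smul_eq_mul]
    field_simp
    ring
  have hmom : (1 / (n : ℝ)) * ∑ k ∈ Finset.range n, x k ω ^ 2 =
      Q n ω + 2 * μ * M n ω + μ ^ 2 := by
    have : ∑ k ∈ Finset.range n, x k ω ^ 2 = ∑ k ∈ Finset.range n, (x k ω - μ) ^ 2 +
        2 * μ * ∑ k ∈ Finset.range n, (x k ω - μ) + n * μ ^ 2 := by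
      rw [Finset.mul_sum, ← Finset.sum_add_distrib, ← sub_eq_iff_eq_add', ← Finset.sum_sub_distrib]
      rw [Finset.sum_congr rfl fun k _ ↦ show _ = μ ^ 2 by ring]
      simp
    simp only [hM, hQ, this, smul_eq_mul]
    field_simp
  have hA : (√(n : ℝ))⁻¹ * ∑ k ∈ Finset.range n, (x k ω - μ) = √(n : ℝ) * M n ω := by
    simp only [hM, smul_eq_mul]
    field_simp
    rw [hNN, mul_comm]
  have hB : (√(n : ℝ))⁻¹ * (∑ k ∈ Finset.range n, (x k ω - μ) ^ 2 - n * σ ^ 2) =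
      √(n : ℝ) * (Q n ω - σ ^ 2) := by
    simp only [hQ, smul_eq_mul]
    field_simp
    rw [hNN]
  have hL : (√(n : ℝ))⁻¹ * ∑ k ∈ Finset.range n,
      ((x k ω - μ) / σ - d / σ / 2 * (((x k ω - μ) / σ) ^ 2 - 1)) =
      √(n : ℝ) * M n ω / σ - d / σ / 2 * (√(n : ℝ) * (Q n ω - σ ^ 2) / σ ^ 2) := by
    have e (k : ℕ) : (x k ω - μ) / σ - d / σ / 2 * (((x k ω - μ) / σ) ^ 2 - 1) =
        σ⁻¹ * (x k ω - μ) - d / σ / 2 / σ ^ 2 * ((x k ω - μ) ^ 2 - σ ^ 2) := by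
      field_simp
    simp_rw [e]
    rw [← hA, ← hB, Finset.sum_sub_distrib, ← Finset.mul_sum, ← Finset.mul_sum,
      Finset.sum_sub_distrib (fun k ↦ (x k ω - μ) ^ 2)]
    simp only [Finset.sum_const, Finset.card_range, nsmul_eq_mul]
    ring
  have key := sharpe_remainder_identity (N := √(n : ℝ)) (d := d) hσ hpos hsq
  simp only [Pi.mul_apply, Pi.zero_apply]
  rw [hmean, hmom, hL, hA, hB, eq_comm, sub_eq_zero, ← key, hd]
  simp only [hs]
  congr 4
  · ring
  · congr 1
    ring

end Linearization

end Sharpe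

/-! ### The limit law of the sample Sharpe ratios -/

theorem mainTheorem3 {p : ℕ} {Ω : Type*} [MeasurableSpace Ω]
    (P : Measure Ω) [IsProbabilityMeasure P]
    (ν : Measure (EuclideanSpace ℝ (Fin p)))
    (hell : Sharpe.IsElliptical ν)
    (hmom : MemLp id 4 ν)
    (hvar : ∀ i, 0 < Sharpe.popCov ν i i)
    (X : ℕ → Ω → EuclideanSpace ℝ (Fin p))
    (hlaw : ∀ k, HasLaw (X k) ν P)
    (hindep : iIndepFun X P)
    (r : ℝ) :
    ∃ κ : ℝ, (∀ i, κ = Sharpe.popKurt ν i / 3) ∧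
      (Sharpe.asympCov κ (Sharpe.popCorr ν) (Sharpe.popSNR ν r)).PosSemidef ∧
      TendstoInDistribution
        (fun (n : ℕ) (ω : Ω) =>
          √(n : ℝ) • (Sharpe.sampleSharpe (fun k => X k ω) n r - Sharpe.popSNR ν r))
        atTop
        (id : EuclideanSpace ℝ (Fin p) → EuclideanSpace ℝ (Fin p))
        (fun _ => P)
        (multivariateGaussian 0
          (Sharpe.asympCov κ (Sharpe.popCorr ν) (Sharpe.popSNR ν r))) ∧
      ∀ i, Sharpe.asympCov κ (Sharpe.popCorr ν) (Sharpe.popSNR ν r) i i =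
        Sharpe.mertensVariance (Sharpe.popSkew ν i) (Sharpe.popKurt ν i)
          (Sharpe.popSNR ν r i) := by
  have : IsProbabilityMeasure ν := (hlaw 0).isProbabilityMeasure_iff.1 ‹_›
  have hident (k : ℕ) : IdentDistrib (X k) (X 0) P P := (hlaw k).identDistrib (hlaw 0)
  have mX (k : ℕ) : AEMeasurable (X k) P := (hlaw k).aemeasurable
  obtain ⟨κ, hκ⟩ : ∃ κ : ℝ, ∀ i, κ = Sharpe.popKurt ν i / 3 := by
    rcases isEmpty_or_nonempty (Fin p) with h | ⟨⟨i₀⟩⟩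
    -- without assets `κ` is unconstrained and the matrix is empty
    · exact ⟨0, fun i ↦ h.elim i⟩
    · exact ⟨Sharpe.popKurt ν i₀ / 3, fun i ↦ by rw [Sharpe.popKurt_eq hell hmom hvar i₀ i]⟩
  have hS (i j : Fin p) : Sharpe.asympCov κ (Sharpe.popCorr ν) (Sharpe.popSNR ν r) i j =
      ∫ x, Sharpe.influence ν r x i * Sharpe.influence ν r x j ∂ν := by
    rw [Sharpe.integral_influence_mul hell hmom hvar, hκ i]
  refine ⟨κ, hκ, Sharpe.posSemidef_of_eq_integral_mul (P := ν) (Y := Sharpe.influence ν r)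
    (Sharpe.memLp_influence hmom r) hS, ?_, fun i ↦ ?_⟩
  · have mψ := Sharpe.measurable_influence (ν := ν) r
    have hcomp {f : EuclideanSpace ℝ (Fin p) → ℝ} (hf : Measurable f) :
        ∫ ω, f (X 0 ω) ∂P = ∫ x, f x ∂ν := (hlaw 0).integral_comp hf.aestronglyMeasurable
    have hLp {f : EuclideanSpace ℝ (Fin p) → ℝ} (hf : MemLp f 2 ν) :
        MemLp (fun ω ↦ f (X 0 ω)) 2 P := by
      rw [← (hlaw 0).map_eq] at hf
      exact hf.comp_of_map (mX 0)
    have hL := Sharpe.tendstoInDistribution_inv_sqrt_smul_sum (P := P)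
      (Y := fun k ω ↦ Sharpe.influence ν r (X k ω))
      (S := Sharpe.asympCov κ (Sharpe.popCorr ν) (Sharpe.popSNR ν r))
      (fun i ↦ hLp (Sharpe.memLp_influence hmom r i))
      (fun i ↦ by
        rw [hcomp (f := fun x ↦ Sharpe.influence ν r x i) (by fun_prop),
          Sharpe.integral_influence hmom hvar])
      (fun i j ↦ by
        rw [hS, hcomp (f := fun x ↦ Sharpe.influence ν r x i * Sharpe.influence ν r x j)
          (by fun_prop)])
      (hindep.comp (fun _ ↦ Sharpe.influence ν r) fun _ ↦ mψ) (fun k ↦ (hident k).comp mψ)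
    refine tendstoInDistribution_of_tendstoInMeasure_sub _ _ hL
      (Sharpe.tendstoInMeasure_euclideanSpace fun i ↦ ?_) fun n ↦ ?_
    · have me : Measurable fun x : EuclideanSpace ℝ (Fin p) ↦ x i := by fun_prop
      have key := Sharpe.tendstoInMeasure_sharpe_remainder (P := P) (x := fun k ω ↦ X k ω i)
        (μ := Sharpe.popMean ν i) r (Sharpe.popSigma_pos (hvar i))
        (hLp (Sharpe.memLp_centred_two hmom i))
        (hLp (f := fun x ↦ (x i - Sharpe.popMean ν i) ^ 2)
          (by simpa only [sq] using Sharpe.memLp_centred_mul hmom i i))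
        (by rw [hcomp (f := fun x ↦ x i - Sharpe.popMean ν i) (by fun_prop),
          Sharpe.integral_centred hmom])
        (by rw [hcomp (f := fun x ↦ (x i - Sharpe.popMean ν i) ^ 2) (by fun_prop),
          Sharpe.integral_centred_sq, Sharpe.popSigma_sq (hvar i)])
        (hindep.comp (fun _ x ↦ x i) fun _ ↦ me) (fun k ↦ (hident k).comp me)
      refine key.congr_left fun n ↦ .of_forall fun ω ↦ ?_
      simp [Sharpe.sampleSharpe, Sharpe.sampleMean, Sharpe.sampleMom2, Sharpe.influence,
        Sharpe.popSNR_apply hmom]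
    · unfold Sharpe.sampleSharpe Sharpe.sampleMean Sharpe.sampleMom2
      fun_prop
  · rw [Sharpe.asympCov_apply, Sharpe.popCorr_self (hvar i), Sharpe.mertensVariance,
      Sharpe.popSkew_eq_zero hell hmom, hκ i]
    ring
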